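/- Let $\mathbb{T}$ be the unit circle with normalized Lebesgue measure $m$, and let $L^0$ be the space of (a.e. equivalence classes of) measurable complex-valued functions on $\mathbb{T}$. A Banach function space is a complex Banach space $X\subset L^0$ such that (a) if $f\in X$, $g\in L^0$ and $|g|\le|f|$ a.e., then $g\in X$ and $\|g\|_X\le\|f\|_X$; (b) $L^\infty\subset X$; (c) if $f_n,f\in X$ and $0\le f_n\uparrow f$ a.e., then $\|f\|_X=\sup_n\|f_n\|_X$. It is rearrangement invariant (r.i.) if, whenever $f\in X$ and $g\in L^0$ satisfy $m\{|f|>\lambda\}=m\{|g|>\lambda\}$ for all $\lambda\ge0$, then $g\in X$ and $\|g\|_X=\|f\|_X$. For sets $A,B\subset L^0$ equipped with functionals $\|\cdot\|_A,\|\cdot\|_B$, put $A\odot B=\{gh: g\in A,\ h\in B\}$ and $\|f\|_{A\odot B}=\inf\{\|g\|_A\|h\|_B: f=gh,\ g\in A,\ h\in B\}$. For $Z\subset L^1$ equipped with a functional $\|\cdot\|_Z$, put $H[Z]=\{f\in Z:\widehat f(n)=0\text{ for all integers }n<0\}$, with $\|f\|_{H[Z]}=\|f\|_Z$, where $\widehat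 f(n)=\int_{\mathbb T}f(t)\,t^{-n}\,dm(t)$. (Every r.i. Banach function space is contained in $L^1$.) Theorem. Let $X,Y$ be r.i. Banach function spaces on $\mathbb{T}$ with $X\odot Y\subset L^1$. Then $$H[X]\odot H[Y]\equiv H[X\odot Y],$$ that is, the two sides are equal as sets and $\|f\|_{H[X]\odot H[Y]}=\|f\|_{X\odot Y}$ for every $f$ in them. -/

import Mathlib

open MeasureTheory Filter Topology

instance fact_zero_lt_two_pi : Fact (0 < 2 * Real.pi) := ⟨Real.two_pi_pos⟩

/-- The circle `𝕋`, parametrised by the angle `θ ∈ ℝ / 2πℤ` (the point being `t = e^{iθ}`). -/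
abbrev Torus : Type := AddCircle (2 * Real.pi)

/-- The normalized Lebesgue measure on the circle. -/
noncomputable abbrev torusMeasure : Measure Torus := AddCircle.haarAddCircle

/-- `L⁰(𝕋, m)`: a.e.-classes of measurable complex-valued functions on the circle. -/
abbrev LZero : Type := Torus →ₘ[torusMeasure] ℂ

/-- A set of (classes of) functions on the circle together with a real functional.
Only the values of `nrm` on `carrier` are meaningful. -/
structure FunctionClass where
  carrier : Set LZero
  nrm : LZero → ℝ

/-- `f` and `g` are equimeasurable: `|f|` and `|g|` have the same distribution function. -/
def Equimeasurable (f g : LZero) : Prop :=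
  ∀ c : ℝ, 0 ≤ c → torusMeasure {t | c < ‖f t‖} = torusMeasure {t | c < ‖g t‖}

namespace FunctionClass

open scoped ComplexOrder in
/-- Banach function spaces on the circle: complex Banach spaces `X ⊆ L⁰` that have the ideal
property, contain `L^∞`, and have the semi-Fatou property. In the latter, inequalities between
complex numbers are those of the order in which `0 ≤ z` means that `z` is real and nonnegative. -/
structure IsBanachFunctionSpace (X : FunctionClass) : Prop where
  zero_mem : (0 : LZero) ∈ X.carrier
  add_mem : ∀ f ∈ X.carrier, ∀ g ∈ X.carrier, f + g ∈ X.carrier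
  smul_mem : ∀ (c : ℂ), ∀ f ∈ X.carrier, c • f ∈ X.carrier
  nrm_nonneg : ∀ f ∈ X.carrier, 0 ≤ X.nrm f
  nrm_eq_zero_iff : ∀ f ∈ X.carrier, (X.nrm f = 0 ↔ f = 0)
  nrm_smul : ∀ (c : ℂ), ∀ f ∈ X.carrier, X.nrm (c • f) = ‖c‖ * X.nrm f
  nrm_add_le : ∀ f ∈ X.carrier, ∀ g ∈ X.carrier, X.nrm (f + g) ≤ X.nrm f + X.nrm g
  complete : ∀ u : ℕ → LZero, (∀ n, u n ∈ X.carrier) →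
    (∀ ε : ℝ, 0 < ε → ∃ N : ℕ, ∀ m ≥ N, ∀ n ≥ N, X.nrm (u m - u n) < ε) →
    ∃ f ∈ X.carrier, Tendsto (fun n => X.nrm (u n - f)) atTop (𝓝 0)
  ideal : ∀ f ∈ X.carrier, ∀ g : LZero, (∀ᵐ t ∂torusMeasure, ‖g t‖ ≤ ‖f t‖) →
    g ∈ X.carrier ∧ X.nrm g ≤ X.nrm f
  linfty_subset : ∀ f : LZero, MemLp f ⊤ torusMeasure → f ∈ X.carrier
  semiFatou : ∀ (u : ℕ → LZero) (f : LZero), (∀ n, u n ∈ X.carrier) → f ∈ X.carrier →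
    (∀ᵐ t ∂torusMeasure, (∀ n, 0 ≤ u n t) ∧ Monotone (fun n => u n t) ∧
      Tendsto (fun n => u n t) atTop (𝓝 (f t))) →
    IsLUB (Set.range fun n => X.nrm (u n)) (X.nrm f)

/-- Rearrangement invariance. -/
def IsRearrangementInvariant (X : FunctionClass) : Prop :=
  ∀ f g : LZero, Equimeasurable f g → f ∈ X.carrier → g ∈ X.carrier ∧ X.nrm f = X.nrm g

/-- The inclusion `X ⊆ L¹`. -/
def SubsetLOne (X : FunctionClass) : Prop :=
  ∀ f ∈ X.carrier, Integrable f torusMeasure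

/-- The pointwise product `X ⊙ Y`, with `‖f‖ = inf {‖g‖_X ‖h‖_Y : f = g h, g ∈ X, h ∈ Y}`. -/
noncomputable def prod (X Y : FunctionClass) : FunctionClass where
  carrier := {f | ∃ g ∈ X.carrier, ∃ h ∈ Y.carrier, f = g * h}
  nrm f := sInf {r | ∃ g ∈ X.carrier, ∃ h ∈ Y.carrier, f = g * h ∧ r = X.nrm g * Y.nrm h}

/-- The Hardy space `H[X]`: the elements of `X` whose Fourier coefficients of negative index vanish,
with the functional of `X`. It is considered for `X ⊆ L¹`, where the integrability clause, which
makes the Fourier coefficients meaningful, holds automatically. -/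
noncomputable def hardy (X : FunctionClass) : FunctionClass where
  carrier := {f | f ∈ X.carrier ∧ Integrable f torusMeasure ∧ ∀ n : ℤ, n < 0 → fourierCoeff f n = 0}
  nrm := X.nrm

/-- `X ≡ Y`: the two classes have the same elements, with the same values of the functional. -/
def IsometricallyEqual (X Y : FunctionClass) : Prop :=
  X.carrier = Y.carrier ∧ ∀ f ∈ X.carrier, X.nrm f = Y.nrm f

end FunctionClass

/-!
For `w ≥ δ > 0` integrable on the circle, let `u` be the component of `s = √w` orthogonal in `L²` to
the functions `e^{int} s` with `n ≥ 1` (the extremal problem of Szegő). Then `s ū` has no negative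
frequencies, and `u` lies in the closed span of the `e^{int} s` with `n ≥ 0`; hence neither
`|u|² = u ū` nor its conjugate has negative frequencies, so `|u|²` is a constant `c`. Consequently
`p = u / s` satisfies `|p|² w = c`, and `p` and `1 / p = s ū / c` are both analytic.

This is used twice. First, `G = c p⁻²` is analytic with analytic inverse and `|G| = w`. Secondly,
for `w = 1 + W / n` with `n → ∞` the functions `p²` are bounded and analytic, they tend to `1`, and
`p² f` is bounded whenever `|f| ≤ W`; with `W = |g| + |h|` this reduces to the case of `L²` the fact
that the product of `g, h ∈ H¹` is in `H¹` as soon as it is integrable.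

Now if `g ∈ X`, `h ∈ Y` and `g h` is analytic, take `G` with `|G| = |g| + δ` and `H = g h / G`. Then
`g h = G H` is a factorization into analytic functions with `|H| ≤ |h|` and
`‖G‖ ≤ ‖g‖ + δ ‖1‖`, and `δ → 0` gives the equality of the norms.
-/

section Circle

open AddCircle

variable {T : ℝ} [Fact (0 < T)]

local notation "μ" => haarAddCircle (T := T)

theorem fourierCoeff_fourier_mul (f : AddCircle T → ℂ) (k n : ℤ) :
    fourierCoeff (⇑(fourier k) * f) n = fourierCoeff f (n - k) := by
  simp only [fourierCoeff, Pi.mul_apply, smul_eq_mul, ← mul_assoc, ← fourier_add, neg_sub',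
    sub_neg_eq_add]

theorem fourierCoeff_one : fourierCoeff (1 : AddCircle T → ℂ) = Pi.single 0 1 := by
  rw [← fourierCoeff_fourier (T := T)]
  congr 1 with t
  exact fourier_zero.symm

theorem fourierCoeff_star (f : AddCircle T → ℂ) (n : ℤ) :
    fourierCoeff (star f) n = star (fourierCoeff f (-n)) := by
  simp only [fourierCoeff, smul_eq_mul, Pi.star_apply, RCLike.star_def, neg_neg, ← integral_conj,
    map_mul, fourier_neg]

theorem fourierCoeff_zero_eq_integral (f : AddCircle T → ℂ) :
    fourierCoeff f 0 = ∫ t, f t ∂μ := by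
  simp only [fourierCoeff, neg_zero, fourier_zero, one_smul]

theorem integral_continuousMap_mul_eq_zero {f : AddCircle T → ℂ} (hf : Integrable f μ)
    (h : ∀ n, fourierCoeff f n = 0) (φ : C(AddCircle T, ℂ)) : ∫ t, φ t * f t ∂μ = 0 := by
  have hint (ψ : C(AddCircle T, ℂ)) : Integrable (fun t => ψ t * f t) μ :=
    hf.bdd_mul ψ.continuous.aestronglyMeasurable (ae_of_all _ ψ.norm_coe_le_norm)
  let L : C(AddCircle T, ℂ) →ₗ[ℂ] ℂ :=
    { toFun ψ := ∫ t, ψ t * f t ∂μ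
      map_add' ψ χ := by
        simpa only [ContinuousMap.add_apply, add_mul] using integral_add (hint ψ) (hint χ)
      map_smul' c ψ := by
        simpa only [ContinuousMap.smul_apply, smul_mul_assoc, RingHom.id_apply] using
          integral_smul c fun t => ψ t * f t }
  have hbound (ψ : C(AddCircle T, ℂ)) : ‖L ψ‖ ≤ (∫ t, ‖f t‖ ∂μ) * ‖ψ‖ := by
    refine (norm_integral_le_integral_norm _).trans ?_
    rw [mul_comm, ← integral_const_mul]
    refine integral_mono (hint ψ).norm (hf.norm.const_mul _) fun t => ?_
    rw [norm_mul]
    gcongr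
    exact ψ.norm_coe_le_norm t
  let L' := L.mkContinuous _ hbound
  have hspan : (Submodule.span ℂ (Set.range (@fourier T))).topologicalClosure ≤ L'.ker := by
    refine Submodule.topologicalClosure_minimal _ (Submodule.span_le.2 ?_) L'.isClosed_ker
    rintro _ ⟨n, rfl⟩
    change ∫ t, fourier n t * f t ∂μ = 0
    simpa only [fourierCoeff, neg_neg, smul_eq_mul] using h (-n)
  rw [span_fourier_closure_eq_top] at hspan
  exact hspan Submodule.mem_top

theorem ae_eq_zero_of_fourierCoeff_eq_zero {f : AddCircle T → ℂ} (hf : Integrable f μ)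
    (h : ∀ n, fourierCoeff f n = 0) : f =ᵐ[μ] 0 := by
  refine ae_eq_zero_of_forall_setIntegral_isClosed_eq_zero hf fun s hs => ?_
  let φ (n : ℕ) : C(AddCircle T, ℂ) :=
    ⟨fun t => ((hs.apprSeq n t : ℝ) : ℂ), by fun_prop⟩
  have hφ (t : AddCircle T) :
      Tendsto (fun n => φ n t * f t) atTop (𝓝 (s.indicator f t)) := by
    have happr := tendsto_pi_nhds.1 (HasOuterApproxClosed.tendsto_apprSeq hs) t
    have hcoe : Continuous fun x : NNReal => ((x : ℝ) : ℂ) := by fun_prop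
    have hind : s.indicator f t =
        (((s.indicator (fun _ => (1 : NNReal)) t : NNReal) : ℝ) : ℂ) * f t := by
      by_cases ht : t ∈ s <;> simp [ht]
    rw [hind]
    exact ((hcoe.tendsto _).comp happr).mul_const (f t)
  have hlim := tendsto_integral_of_dominated_convergence (F := fun n t => φ n t * f t)
    (fun t => ‖f t‖)
    (fun n => (φ n).continuous.aestronglyMeasurable.mul hf.1) hf.norm
    (fun n => ae_of_all _ fun t => by
      have hle : (hs.apprSeq n t : ℝ) ≤ 1 := HasOuterApproxClosed.apprSeq_apply_le_one hs n t
      rw [norm_mul]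
      refine mul_le_of_le_one_left (norm_nonneg _) ?_
      simpa [φ] using hle)
    (ae_of_all _ hφ)
  simp only [integral_continuousMap_mul_eq_zero hf h] at hlim
  rw [← integral_indicator hs.measurableSet]
  exact tendsto_nhds_unique hlim tendsto_const_nhds

/-- The Hardy class `H¹` of the circle. -/
def MemHardy (f : AddCircle T → ℂ) : Prop :=
  Integrable f μ ∧ ∀ n : ℤ, n < 0 → fourierCoeff f n = 0

namespace MemHardy

variable {f g : AddCircle T → ℂ}

theorem one : MemHardy (1 : AddCircle T → ℂ) :=
  ⟨integrable_const 1, fun n hn => by rw [fourierCoeff_one, Pi.single_eq_of_ne hn.ne]⟩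

theorem congr (hf : MemHardy f) (h : f =ᵐ[μ] g) : MemHardy g :=
  ⟨hf.1.congr h, fun n hn => by rw [← fourierCoeff_congr_ae h, hf.2 n hn]⟩

theorem const_smul (hf : MemHardy f) (c : ℂ) : MemHardy (c • f) :=
  ⟨hf.1.smul c, fun n hn => by rw [fourierCoeff.const_smul, hf.2 n hn, smul_zero]⟩

theorem of_tendsto {F : ℕ → AddCircle T → ℂ} {b : AddCircle T → ℝ} (hF : ∀ n, MemHardy (F n))
    (hb : Integrable b μ) (hbound : ∀ n, ∀ᵐ t ∂μ, ‖F n t‖ ≤ b t)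
    (hlim : ∀ᵐ t ∂μ, Tendsto (fun n => F n t) atTop (𝓝 (f t))) : MemHardy f := by
  have hint : Integrable f μ := by
    refine hb.mono' (aestronglyMeasurable_of_tendsto_ae atTop (fun n => (hF n).1.1) hlim) ?_
    filter_upwards [hlim, ae_all_iff.2 hbound] with t ht hbt
    exact le_of_tendsto' ht.norm hbt
  refine ⟨hint, fun k hk => ?_⟩
  have hcoeff : Tendsto (fun n => fourierCoeff (F n) k) atTop (𝓝 (fourierCoeff f k)) := by
    refine tendsto_integral_of_dominated_convergence b
      (fun n => ((hF n).1.fourier_smul (-k)).1) hb (fun n => ?_) ?_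
    · filter_upwards [hbound n] with t ht
      rwa [norm_smul, fourier_apply, Circle.norm_coe, one_mul]
    · filter_upwards [hlim] with t ht using ht.const_smul _
  simp only [fun n => (hF n).2 k hk] at hcoeff
  exact tendsto_nhds_unique hcoeff tendsto_const_nhds

theorem ae_eq_const_of_star (hf : MemHardy f) (hf' : MemHardy (star f)) :
    f =ᵐ[μ] fun _ => ∫ t, f t ∂μ := by
  set c := ∫ t, f t ∂μ with hc
  have hint : Integrable ((-c) • (1 : AddCircle T → ℂ)) μ := (integrable_const 1).smul (-c)
  have hzero : f + (-c) • (1 : AddCircle T → ℂ) =ᵐ[μ] 0 := by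
    refine ae_eq_zero_of_fourierCoeff_eq_zero (hf.1.add hint) fun n => ?_
    rw [fourierCoeff.add hf.1 hint, Pi.add_apply, fourierCoeff.const_smul, fourierCoeff_one]
    rcases lt_trichotomy n 0 with hn | rfl | hn
    · rw [hf.2 n hn, Pi.single_eq_of_ne hn.ne, smul_zero, add_zero]
    · rw [fourierCoeff_zero_eq_integral, Pi.single_eq_same, ← hc, smul_eq_mul, mul_one,
        add_neg_cancel]
    · have hstar := hf'.2 (-n) (by lia)
      rw [fourierCoeff_star, neg_neg, star_eq_zero] at hstar
      rw [hstar, Pi.single_eq_of_ne hn.ne', smul_zero, add_zero]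
  filter_upwards [hzero] with t ht
  simpa [← sub_eq_add_neg, sub_eq_zero] using ht

end MemHardy

/-! ### Closed spans of nonnegative frequencies -/

theorem exists_continuousLinearMap_eq_fourierCoeff_mul {v : AddCircle T → ℂ} (hv : MemLp v 2 μ)
    (n : ℤ) : ∃ L : Lp ℂ 2 μ →L[ℂ] ℂ, ∀ u : Lp ℂ 2 μ, L u = fourierCoeff (⇑u * v) n := by
  have ha : MemLp (star (⇑(fourier (-n)) * v)) 2 μ :=
    hv.congr_norm ((fourier (-n)).continuous.aestronglyMeasurable.mul hv.1).star
      (ae_of_all _ fun t => by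
        rw [Pi.star_apply, norm_star, Pi.mul_apply, norm_mul, fourier_apply, Circle.norm_coe,
          one_mul])
  refine ⟨innerSL ℂ (ha.toLp _), fun u => ?_⟩
  rw [innerSL_apply_apply, L2.inner_def, fourierCoeff]
  refine integral_congr_ae ?_
  filter_upwards [ha.coeFn_toLp] with t ht
  simp only [ht, RCLike.inner_apply, Pi.star_apply, Pi.mul_apply, RCLike.star_def,
    starRingEnd_self_apply, smul_eq_mul]
  ring

/-- The closed span in `L²` of the functions `e^{int} s(t)` with `n ≥ 0`. -/
noncomputable def analyticSpan (s : AddCircle T → ℂ) : Submodule ℂ (Lp ℂ 2 μ) :=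
  (Submodule.span ℂ {v : Lp ℂ 2 μ | ∃ n : ℕ, v =ᵐ[μ] ⇑(fourier n) * s}).topologicalClosure

theorem mem_analyticSpan {s : AddCircle T → ℂ} {v : Lp ℂ 2 μ} (n : ℕ)
    (hv : v =ᵐ[μ] ⇑(fourier n) * s) : v ∈ analyticSpan s :=
  Submodule.le_topologicalClosure _ (Submodule.subset_span ⟨n, hv⟩)

theorem analyticSpan_fourier_one_mul_le (s : AddCircle T → ℂ) :
    analyticSpan (⇑(fourier 1) * s) ≤ analyticSpan s := by
  refine Submodule.topologicalClosure_mono (Submodule.span_mono ?_)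
  rintro v ⟨n, hv⟩
  refine ⟨n + 1, hv.trans (ae_of_all _ fun t => ?_)⟩
  simp only [Pi.mul_apply, Nat.cast_succ, fourier_add, mul_assoc]

theorem fourierCoeff_mul_eq_zero_of_mem_analyticSpan {s v : AddCircle T → ℂ} {u : Lp ℂ 2 μ}
    (hu : u ∈ analyticSpan s) (hv : MemLp v 2 μ) {n : ℤ}
    (h : ∀ k : ℕ, fourierCoeff (s * v) (n - k) = 0) : fourierCoeff (⇑u * v) n = 0 := by
  obtain ⟨L, hL⟩ := exists_continuousLinearMap_eq_fourierCoeff_mul hv n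
  have hle : analyticSpan s ≤ L.ker := by
    refine Submodule.topologicalClosure_minimal _ (Submodule.span_le.2 ?_) L.isClosed_ker
    rintro u ⟨k, hu⟩
    change L u = 0
    have hmul : ⇑u * v =ᵐ[μ] ⇑(fourier k) * (s * v) := by
      simpa only [mul_assoc] using hu.mul (ae_eq_refl v)
    rw [hL, fourierCoeff_congr_ae hmul, fourierCoeff_fourier_mul, h]
  rw [← hL]
  exact hle hu

theorem memHardy_mul_of_mem_analyticSpan {s v : AddCircle T → ℂ} {u : Lp ℂ 2 μ}
    (hu : u ∈ analyticSpan s) (hv : MemLp v 2 μ) (hsv : MemHardy (s * v)) :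
    MemHardy (⇑u * v) :=
  ⟨(Lp.memLp u).integrable_mul hv, fun n hn =>
    fourierCoeff_mul_eq_zero_of_mem_analyticSpan hu hv fun k => hsv.2 _ (by lia)⟩

theorem integral_mul_eq_zero_of_mem_analyticSpan {s v : AddCircle T → ℂ} {u : Lp ℂ 2 μ}
    (hu : u ∈ analyticSpan (⇑(fourier 1) * s)) (hv : MemLp v 2 μ) (hsv : MemHardy (s * v)) :
    ∫ t, u t * v t ∂μ = 0 := by
  refine (fourierCoeff_zero_eq_integral (⇑u * v)).symm.trans
    (fourierCoeff_mul_eq_zero_of_mem_analyticSpan hu hv fun k => ?_)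
  rw [mul_assoc, fourierCoeff_fourier_mul]
  exact hsv.2 _ (by lia)

theorem MemHardy.toLp_mem_analyticSpan_one {f : AddCircle T → ℂ} (hf : MemHardy f)
    (hf2 : MemLp f 2 μ) : hf2.toLp f ∈ analyticSpan (1 : AddCircle T → ℂ) := by
  refine Submodule.isClosed_topologicalClosure _ |>.mem_of_tendsto
    (hasSum_fourier_series_L2 (hf2.toLp f)) (Eventually.of_forall fun F => ?_)
  refine Submodule.sum_mem (p := analyticSpan 1) fun n _ => ?_
  rw [fourierCoeff_congr_ae hf2.coeFn_toLp]
  rcases lt_or_ge n 0 with hn | hn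
  · rw [hf.2 n hn, zero_smul]
    exact Submodule.zero_mem _
  · lift n to ℕ using hn
    refine Submodule.smul_mem _ _ (mem_analyticSpan n ?_)
    simpa only [mul_one] using coeFn_fourierLp 2 (n : ℤ)

theorem MemHardy.mul_of_memLp_two {f g : AddCircle T → ℂ} (hf : MemHardy f) (hg : MemHardy g)
    (hf2 : MemLp f 2 μ) (hg2 : MemLp g 2 μ) : MemHardy (f * g) :=
  (memHardy_mul_of_mem_analyticSpan (hf.toLp_mem_analyticSpan_one hf2) hg2
    (by rwa [one_mul])).congr (hf2.coeFn_toLp.mul (ae_eq_refl g))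

/-! ### The extremal problem of Szegő -/

/-- The component of `s` orthogonal in `L²` to the closed span of the functions `e^{int} s(t)` with
`n ≥ 1`. -/
noncomputable def innovation {s : AddCircle T → ℂ} (hs : MemLp s 2 μ) : Lp ℂ 2 μ :=
  (analyticSpan (⇑(fourier 1) * s))ᗮ.starProjection (hs.toLp s)

theorem innovation_mem_orthogonal {s : AddCircle T → ℂ} (hs : MemLp s 2 μ) :
    innovation hs ∈ (analyticSpan (⇑(fourier 1) * s))ᗮ :=
  Submodule.starProjection_apply_mem _ _

theorem toLp_sub_innovation_mem {s : AddCircle T → ℂ} (hs : MemLp s 2 μ) :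
    hs.toLp s - innovation hs ∈ analyticSpan (⇑(fourier 1) * s) := by
  have : CompleteSpace (analyticSpan (⇑(fourier 1) * s)) :=
    (Submodule.isClosed_topologicalClosure _).completeSpace_coe
  rw [← (analyticSpan (⇑(fourier 1) * s)).orthogonal_orthogonal]
  exact Submodule.sub_starProjection_mem_orthogonal _

theorem norm_innovation_le {s : AddCircle T → ℂ} (hs : MemLp s 2 μ) :
    ‖innovation hs‖ ≤ ‖hs.toLp s‖ :=
  Submodule.norm_starProjection_apply_le _ _

theorem innovation_mem_analyticSpan {s : AddCircle T → ℂ} (hs : MemLp s 2 μ) :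
    innovation hs ∈ analyticSpan s := by
  rw [← sub_sub_cancel (hs.toLp s) (innovation hs)]
  refine Submodule.sub_mem _ (mem_analyticSpan 0 (hs.coeFn_toLp.trans (ae_of_all _ fun t => ?_)))
    (analyticSpan_fourier_one_mul_le _ (toLp_sub_innovation_mem hs))
  simp only [Nat.cast_zero, Pi.mul_apply, fourier_zero, one_mul]

theorem memHardy_mul_star_innovation {s : AddCircle T → ℂ} (hs : MemLp s 2 μ) :
    MemHardy (s * star ⇑(innovation hs)) := by
  refine ⟨hs.integrable_mul (Lp.memLp (innovation hs)).star, fun n hn => ?_⟩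
  obtain ⟨k, rfl⟩ : ∃ k : ℕ, n = -(k + 1) := ⟨(-n - 1).toNat, by lia⟩
  have hshift : MemLp (⇑(fourier (k + 1 : ℤ)) * s) 2 μ :=
    hs.congr_norm ((fourier _).continuous.aestronglyMeasurable.mul hs.1) (ae_of_all _ fun t => by
      rw [Pi.mul_apply, norm_mul, fourier_apply, Circle.norm_coe, one_mul])
  have hmem : hshift.toLp _ ∈ analyticSpan (⇑(fourier 1) * s) := by
    refine mem_analyticSpan k (hshift.coeFn_toLp.trans (ae_of_all _ fun t => ?_))
    simp only [Pi.mul_apply, fourier_add, mul_assoc]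
  have hinner := (Submodule.mem_orthogonal' _ _).1 (innovation_mem_orthogonal hs) _ hmem
  rw [L2.inner_def] at hinner
  rw [← hinner, fourierCoeff]
  refine integral_congr_ae ?_
  filter_upwards [hshift.coeFn_toLp] with t ht
  rw [ht, RCLike.inner_apply, neg_neg, smul_eq_mul, Pi.mul_apply, Pi.mul_apply, Pi.star_apply,
    mul_assoc, RCLike.star_def]

theorem norm_sq_eq_integral {α : Type*} [MeasurableSpace α] {ν : Measure α} (u : Lp ℂ 2 ν) :
    ‖u‖ ^ 2 = ∫ t, ‖u t‖ ^ 2 ∂ν := by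
  have h := (inner_self_eq_norm_sq_to_K (𝕜 := ℂ) u).symm.trans (L2.inner_def u u)
  simp only [inner_self_eq_norm_sq_to_K] at h
  exact_mod_cast h

theorem norm_sq_innovation_ae_eq {s : AddCircle T → ℂ} (hs : MemLp s 2 μ) :
    ∀ᵐ t ∂μ, ‖innovation hs t‖ ^ 2 = ‖innovation hs‖ ^ 2 := by
  set u := innovation hs
  have hmul : MemHardy (⇑u * star ⇑u) :=
    memHardy_mul_of_mem_analyticSpan (innovation_mem_analyticSpan hs) (Lp.memLp u).star
      (memHardy_mul_star_innovation hs)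
  have hnorm : ∫ t, (⇑u * star ⇑u) t ∂μ = ((‖u‖ ^ 2 : ℝ) : ℂ) := by
    simp only [norm_sq_eq_integral, ← integral_complex_ofReal, Pi.mul_apply, Pi.star_apply,
      RCLike.star_def, Complex.mul_conj', Complex.ofReal_pow]
  filter_upwards [hmul.ae_eq_const_of_star (by rwa [star_mul, star_star])] with t ht
  rw [hnorm, Pi.mul_apply, Pi.star_apply, RCLike.star_def, Complex.mul_conj'] at ht
  exact_mod_cast ht

theorem integral_innovation_mul {s v : AddCircle T → ℂ} (hs : MemLp s 2 μ) (hv : MemLp v 2 μ)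
    (hsv : MemHardy (s * v)) : ∫ t, innovation hs t * v t ∂μ = ∫ t, s t * v t ∂μ := by
  have hzero := integral_mul_eq_zero_of_mem_analyticSpan (toLp_sub_innovation_mem hs) hv hsv
  have hint : Integrable (fun t => s t * v t) μ := hsv.1
  have hint' : Integrable (fun t => innovation hs t * v t) μ :=
    (Lp.memLp (innovation hs)).integrable_mul hv
  rw [eq_comm, ← sub_eq_zero, ← hzero, ← integral_sub hint hint']
  refine integral_congr_ae ?_
  filter_upwards [Lp.coeFn_sub (hs.toLp s) (innovation hs), hs.coeFn_toLp] with t ht hst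
  rw [ht, Pi.sub_apply, hst, sub_mul]

theorem memLp_inv_mul_of_norm_le {s f : AddCircle T → ℂ} (hs : MemLp s 2 μ)
    (hf : AEStronglyMeasurable f μ) {C : ℝ} (h : ∀ᵐ t ∂μ, ‖f t‖ ≤ C * ‖s t‖ ^ 2) :
    MemLp (s⁻¹ * f) 2 μ := by
  refine hs.of_le_mul (c := C) (hs.1.inv₀.mul hf) ?_
  filter_upwards [h] with t ht
  rcases eq_or_ne (s t) 0 with h0 | h0
  · simp [h0]
  · rw [Pi.mul_apply, Pi.inv_apply, norm_mul, norm_inv, inv_mul_le_iff₀ (norm_pos_iff.2 h0)]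
    exact ht.trans_eq (by ring)

/-- The properties needed of the solution `p` of the extremal problem of Szegő for a positive weight
`w`: to minimize `∫ |p|² w` over `1 + M`, where `M` is the closed span in `L²(w)` of the functions
`e^{int}` with `n ≥ 1`. The minimum is `c`. -/
structure IsSzegoMinimizer (w : AddCircle T → ℝ) (c : ℝ) (p : AddCircle T → ℂ) : Prop where
  pos : 0 < c
  le_integral : c ≤ ∫ t, w t ∂μ
  norm_sq_eq : ∀ᵐ t ∂μ, ‖p t‖ ^ 2 = c / w t
  integral_eq_one : ∫ t, p t ∂μ = 1
  inv : MemHardy p⁻¹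
  mul : ∀ (f : AddCircle T → ℂ) (C : ℝ), MemHardy f → (∀ᵐ t ∂μ, ‖f t‖ ≤ C * w t) →
    MemHardy (p * f)

theorem integral_inv_mul_innovation {s : AddCircle T → ℂ} (hs : MemLp s 2 μ) {δ : ℝ} (hδ : 0 < δ)
    (hδs : ∀ t, δ ≤ ‖s t‖ ^ 2) : ∫ t, (s⁻¹ * ⇑(innovation hs)) t ∂μ = 1 := by
  have hs0 (t : AddCircle T) : s t ≠ 0 := fun h => by simpa [h, hδ.not_ge] using hδs t
  have hone : s * (s⁻¹ * 1) = 1 := by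
    ext t
    simp [hs0 t]
  have hv : MemLp (s⁻¹ * 1) 2 μ := by
    refine memLp_inv_mul_of_norm_le hs aestronglyMeasurable_one (C := δ⁻¹) (ae_of_all _ fun t => ?_)
    rw [Pi.one_apply, norm_one, ← div_eq_inv_mul, one_le_div hδ]
    exact hδs t
  have hmul := integral_innovation_mul hs hv (by rw [hone]; exact MemHardy.one)
  calc ∫ t, (s⁻¹ * ⇑(innovation hs)) t ∂μ = ∫ t, innovation hs t * (s⁻¹ * 1) t ∂μ := by
        rw [mul_one, mul_comm]
        rfl
    _ = ∫ t, (s * (s⁻¹ * 1)) t ∂μ := hmul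
    _ = 1 := by simp only [hone, Pi.one_apply, integral_const, probReal_univ, one_smul]

theorem isSzegoMinimizer_innovation {s : AddCircle T → ℂ} (hs : MemLp s 2 μ) {δ : ℝ} (hδ : 0 < δ)
    (hδs : ∀ t, δ ≤ ‖s t‖ ^ 2) :
    IsSzegoMinimizer (fun t => ‖s t‖ ^ 2) (‖innovation hs‖ ^ 2) (s⁻¹ * ⇑(innovation hs)) := by
  have hu := norm_sq_innovation_ae_eq hs
  have hstar := memHardy_mul_star_innovation hs
  have hs0 (t : AddCircle T) : s t ≠ 0 := fun h => by simpa [h, hδ.not_ge] using hδs t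
  have hmem := innovation_mem_analyticSpan hs
  have hle := norm_innovation_le hs
  have hone := integral_inv_mul_innovation hs hδ hδs
  generalize innovation hs = u at *
  have hpos : 0 < ‖u‖ ^ 2 := by
    refine (sq_nonneg _).lt_of_ne fun h => one_ne_zero (α := ℂ) ?_
    rw [← hone, integral_eq_zero_of_ae]
    filter_upwards [hu] with t ht
    rw [← h, sq_eq_zero_iff, norm_eq_zero] at ht
    rw [Pi.mul_apply, ht, mul_zero, Pi.zero_apply]
  refine ⟨hpos, ?_, ?_, hone, ?_, fun f C hf hC => ?_⟩
  · calc ‖u‖ ^ 2 ≤ ‖hs.toLp s‖ ^ 2 := by gcongr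
      _ = ∫ t, ‖s t‖ ^ 2 ∂μ := by
        rw [norm_sq_eq_integral]
        exact integral_congr_ae (hs.coeFn_toLp.fun_comp (‖·‖ ^ 2))
  · filter_upwards [hu] with t ht
    rw [← ht, Pi.mul_apply, Pi.inv_apply, norm_mul, norm_inv, inv_mul_eq_div, div_pow]
  · refine (hstar.const_smul ((‖u‖ ^ 2 : ℝ)⁻¹ : ℂ)).congr ?_
    filter_upwards [hu] with t ht
    have hu0 : u t ≠ 0 := norm_ne_zero_iff.1 (pow_ne_zero_iff two_ne_zero |>.1 (ht ▸ hpos.ne'))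
    rw [← ht, Complex.ofReal_pow, ← Complex.mul_conj']
    simp only [Pi.smul_apply, Pi.mul_apply, Pi.star_apply, Pi.inv_apply, mul_inv, inv_inv,
      RCLike.star_def, smul_eq_mul]
    have : starRingEnd ℂ (u t) ≠ 0 := (map_ne_zero _).2 hu0
    field_simp
  · have hsf : s * (s⁻¹ * f) = f := by
      ext t
      simp [hs0 t]
    have hmul := memHardy_mul_of_mem_analyticSpan hmem
      (memLp_inv_mul_of_norm_le hs hf.1.1 hC) (by rwa [hsf])
    rwa [mul_left_comm, ← mul_assoc] at hmul

theorem exists_isSzegoMinimizer {w : AddCircle T → ℝ} (hw : Integrable w μ) {δ : ℝ} (hδ : 0 < δ)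
    (hδw : ∀ t, δ ≤ w t) : ∃ c p, IsSzegoMinimizer w c p := by
  let s (t : AddCircle T) : ℂ := (√(w t) : ℝ)
  have hsw (t : AddCircle T) : ‖s t‖ ^ 2 = w t := by
    rw [Complex.norm_real, Real.norm_of_nonneg (Real.sqrt_nonneg _),
      Real.sq_sqrt (hδ.le.trans (hδw t))]
  have hs : MemLp s 2 μ := by
    refine (memLp_two_iff_integrable_sq_norm ?_).2 (by simpa only [hsw] using hw)
    exact (Complex.continuous_ofReal.comp Real.continuous_sqrt).comp_aestronglyMeasurable hw.1
  have hmin := isSzegoMinimizer_innovation hs hδ (by simpa only [hsw] using hδw)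
  simp only [hsw] at hmin
  exact ⟨_, _, hmin⟩

theorem exists_outer {w : AddCircle T → ℝ} (hw : Integrable w μ) {δ : ℝ} (hδ : 0 < δ)
    (hδw : ∀ t, δ ≤ w t) :
    ∃ G : AddCircle T → ℂ, MemHardy G ∧ MemHardy G⁻¹ ∧ ∀ᵐ t ∂μ, ‖G t‖ = w t := by
  obtain ⟨c, p, hp⟩ := exists_isSzegoMinimizer hw hδ hδw
  have hp1 : MemHardy p := mul_one p ▸ hp.mul 1 δ⁻¹ .one (ae_of_all _ fun t => by
    rw [Pi.one_apply, norm_one, ← div_eq_inv_mul, one_le_div hδ]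
    exact hδw t)
  have hp2 : MemLp p 2 μ := by
    refine MemLp.of_bound hp1.1.1 (√(c / δ)) ?_
    filter_upwards [hp.norm_sq_eq] with t ht
    refine Real.le_sqrt_of_sq_le (ht.trans_le ?_)
    have := hp.pos
    gcongr
    exact hδw t
  have hinv : MemLp p⁻¹ 2 μ := by
    refine (memLp_two_iff_integrable_sq_norm hp.inv.1.1).2 ((hw.div_const c).congr ?_)
    filter_upwards [hp.norm_sq_eq] with t ht
    rw [Pi.inv_apply, norm_inv, inv_pow, ht, inv_div]
  refine ⟨(c : ℂ) • (p⁻¹ * p⁻¹), (hp.inv.mul_of_memLp_two hp.inv hinv hinv).const_smul _, ?_, ?_⟩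
  · convert (hp1.mul_of_memLp_two hp1 hp2 hp2).const_smul (c : ℂ)⁻¹ using 1
    ext t
    simp only [Pi.smul_apply, Pi.mul_apply, Pi.inv_apply, smul_eq_mul, mul_inv, inv_inv]
  · filter_upwards [hp.norm_sq_eq] with t ht
    rw [Pi.smul_apply, Pi.mul_apply, Pi.inv_apply, norm_smul, norm_mul, norm_inv, ← mul_inv, ← sq,
      ht, Complex.norm_real, Real.norm_of_nonneg hp.pos.le, inv_div, mul_div_cancel₀ _ hp.pos.ne']

/-! ### Products in the Hardy class -/

theorem exists_seq_tendsto_ae_of_tendsto_integral_norm {α : Type*} [MeasurableSpace α]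
    {ν : Measure α} {F : ℕ → α → ℝ} (hF : ∀ n, Integrable (F n) ν)
    (h : Tendsto (fun n => ∫ t, ‖F n t‖ ∂ν) atTop (𝓝 0)) :
    ∃ φ : ℕ → ℕ, StrictMono φ ∧ ∀ᵐ t ∂ν, Tendsto (fun n => F (φ n) t) atTop (𝓝 0) := by
  refine (tendstoInMeasure_of_tendsto_eLpNorm (p := 1) one_ne_zero (fun n => (hF n).1)
    (g := fun _ => 0) aestronglyMeasurable_const ?_).exists_seq_tendsto_ae
  have hlim := ENNReal.tendsto_ofReal h
  rw [ENNReal.ofReal_zero] at hlim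
  refine hlim.congr fun n => ?_
  rw [ofReal_integral_norm_eq_lintegral_enorm (hF n), ← eLpNorm_one_eq_lintegral_enorm]
  exact congrArg (eLpNorm · 1 ν) (funext fun t => (sub_zero _).symm)

theorem integral_norm_sub_one_sq {α : Type*} [MeasurableSpace α] {ν : Measure α}
    [IsProbabilityMeasure ν] {f : α → ℂ} (hf : MemLp f 2 ν) (hf1 : ∫ t, f t ∂ν = 1) :
    ∫ t, ‖f t - 1‖ ^ 2 ∂ν = ∫ t, ‖f t‖ ^ 2 ∂ν - 1 := by
  have hint := hf.integrable one_le_two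
  have hsq := hf.integrable_norm_pow two_ne_zero
  have hre : ∫ t, 2 * (f t).re ∂ν = 2 := by
    have h := integral_re hint
    simp only [hf1, RCLike.re_to_complex, Complex.one_re] at h
    rw [integral_const_mul, h, mul_one]
  have hre_int : Integrable (fun t => 2 * (f t).re) ν := hint.re.const_mul 2
  have hdiff : Integrable (fun t => ‖f t‖ ^ 2 - 2 * (f t).re) ν := hsq.sub hre_int
  have hexp (t : α) : ‖f t - 1‖ ^ 2 = ‖f t‖ ^ 2 - 2 * (f t).re + 1 := by
    simp only [Complex.sq_norm, Complex.normSq_apply, Complex.sub_re, Complex.sub_im,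
      Complex.one_re, Complex.one_im]
    ring
  simp only [hexp]
  rw [integral_add hdiff (integrable_const 1), integral_sub hsq hre_int, hre,
    integral_const, probReal_univ, one_smul]
  ring

namespace IsSzegoMinimizer

variable {w : AddCircle T → ℝ} {c : ℝ} {p : AddCircle T → ℂ}

theorem norm_sq_le (hp : IsSzegoMinimizer w c p) (hw : ∀ t, 1 ≤ w t) :
    ∀ᵐ t ∂μ, ‖p t‖ ^ 2 ≤ c := by
  filter_upwards [hp.norm_sq_eq] with t ht
  exact ht.trans_le (div_le_self hp.pos.le (hw t))

theorem norm_le (hp : IsSzegoMinimizer w c p) (hw : ∀ t, 1 ≤ w t) : ∀ᵐ t ∂μ, ‖p t‖ ≤ √c :=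
  (hp.norm_sq_le hw).mono fun _ => Real.le_sqrt_of_sq_le

theorem memLp_two (hp : IsSzegoMinimizer w c p) (hw : ∀ t, 1 ≤ w t) : MemLp p 2 μ :=
  MemLp.of_bound (inv_inv p ▸ hp.inv.1.1.inv₀) _ (hp.norm_le hw)

theorem integral_norm_sub_one_sq_le (hp : IsSzegoMinimizer w c p) (hw : ∀ t, 1 ≤ w t) :
    ∫ t, ‖p t - 1‖ ^ 2 ∂μ ≤ ∫ t, w t ∂μ - 1 := by
  have hp2 := hp.memLp_two hw
  rw [integral_norm_sub_one_sq hp2 hp.integral_eq_one]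
  refine sub_le_sub_right (le_trans ?_ hp.le_integral) 1
  simpa using integral_mono_ae (hp2.integrable_norm_pow two_ne_zero)
    (integrable_const c) (hp.norm_sq_le hw)

theorem mul_mul (hp : IsSzegoMinimizer w c p) (hw : ∀ t, 1 ≤ w t) {f : AddCircle T → ℂ} {C : ℝ}
    (hf : MemHardy f) (hC : ∀ᵐ t ∂μ, ‖f t‖ ≤ C * w t) : MemHardy (p * p * f) := by
  rw [mul_assoc]
  refine hp.mul _ (√c * C) (hp.mul f C hf hC) ?_
  filter_upwards [hp.norm_le hw, hC] with t hpt hft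
  rw [Pi.mul_apply, norm_mul, mul_assoc]
  gcongr

theorem memLp_mul_mul (hp : IsSzegoMinimizer w c p) (hw : ∀ t, 1 ≤ w t) {f : AddCircle T → ℂ}
    {C : ℝ} (hf : MemHardy f) (hC : ∀ᵐ t ∂μ, ‖f t‖ ≤ C * w t) : MemLp (p * p * f) 2 μ := by
  refine MemLp.of_bound (hp.mul_mul hw hf hC).1.1 (c * C) ?_
  filter_upwards [hp.norm_sq_eq, hC] with t hpt hft
  have hwt := zero_lt_one.trans_le (hw t)
  have hc := hp.pos
  calc ‖(p * p * f) t‖ = c / w t * ‖f t‖ := by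
        rw [Pi.mul_apply, Pi.mul_apply, norm_mul, norm_mul, ← sq, hpt]
    _ ≤ c / w t * (C * w t) := by gcongr
    _ = c * C := by field_simp

end IsSzegoMinimizer

theorem exists_analytic_cutoff {W : AddCircle T → ℝ} (hW : Integrable W μ) (hW0 : ∀ t, 0 ≤ W t) :
    ∃ (e : ℕ → AddCircle T → ℂ) (B : ℝ), (∀ n, ∀ᵐ t ∂μ, ‖e n t‖ ≤ B) ∧
      (∀ᵐ t ∂μ, Tendsto (fun n => e n t) atTop (𝓝 1)) ∧
      ∀ n f, MemHardy f → (∀ t, ‖f t‖ ≤ W t) → MemHardy (e n * f) ∧ MemLp (e n * f) 2 μ := by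
  let w (n : ℕ) (t : AddCircle T) : ℝ := 1 + W t / (n + 1)
  have hw (n : ℕ) : Integrable (w n) μ := (integrable_const 1).add (hW.div_const _)
  have hw1 (n : ℕ) (t : AddCircle T) : 1 ≤ w n t :=
    le_add_of_nonneg_right (div_nonneg (hW0 t) n.cast_add_one_pos.le)
  have hwint (n : ℕ) : ∫ t, w n t ∂μ = 1 + (∫ t, W t ∂μ) / (n + 1) := by
    rw [integral_add (integrable_const 1) (hW.div_const _), integral_div, integral_const,
      probReal_univ, one_smul]
  choose c p hp using fun n => exists_isSzegoMinimizer (hw n) one_pos (hw1 n)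
  have hL2 : Tendsto (fun n => ∫ t, ‖‖p n t - 1‖ ^ 2‖ ∂μ) atTop (𝓝 0) := by
    refine squeeze_zero (g := fun n : ℕ => (∫ t, W t ∂μ) / (n + 1))
      (fun n => integral_nonneg fun t => norm_nonneg _) (fun n => ?_)
      (by simpa only [mul_one_div, mul_zero] using
        tendsto_one_div_add_atTop_nhds_zero_nat.const_mul (∫ t, W t ∂μ))
    simpa only [norm_pow, norm_norm, hwint, add_sub_cancel_left] using
      (hp n).integral_norm_sub_one_sq_le (hw1 n)
  obtain ⟨φ, -, hφ⟩ := exists_seq_tendsto_ae_of_tendsto_integral_norm (fun n =>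
    (((hp n).memLp_two (hw1 n)).sub (memLp_const (1 : ℂ))).integrable_norm_pow two_ne_zero) hL2
  refine ⟨fun n => p (φ n) * p (φ n), 1 + ∫ t, W t ∂μ, fun n => ?_, ?_, fun n f hf hfW => ?_⟩
  · filter_upwards [(hp (φ n)).norm_sq_le (hw1 _)] with t ht
    rw [Pi.mul_apply, norm_mul, ← sq]
    refine ht.trans ((hp _).le_integral.trans ?_)
    rw [hwint]
    gcongr
    exact div_le_self (integral_nonneg hW0) (le_add_of_nonneg_left (Nat.cast_nonneg _))
  · filter_upwards [hφ] with t ht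
    have hp1 : Tendsto (fun n => p (φ n) t) atTop (𝓝 1) := by
      rw [tendsto_iff_norm_sub_tendsto_zero]
      simpa using ht.sqrt
    simpa using hp1.mul hp1
  · have hfw : ∀ᵐ t ∂μ, ‖f t‖ ≤ (φ n + 1 : ℝ) * w (φ n) t := ae_of_all _ fun t => by
      refine (hfW t).trans ?_
      rw [mul_add, mul_div_cancel₀ _ (φ n).cast_add_one_ne_zero]
      exact le_add_of_nonneg_left (by positivity)
    exact ⟨(hp _).mul_mul (hw1 _) hf hfw, (hp _).memLp_mul_mul (hw1 _) hf hfw⟩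

theorem MemHardy.mul {g h : AddCircle T → ℂ} (hg : MemHardy g) (hh : MemHardy h)
    (hgh : Integrable (g * h) μ) : MemHardy (g * h) := by
  obtain ⟨e, B, hbound, hlim, he⟩ := exists_analytic_cutoff (hg.1.norm.add hh.1.norm) fun t =>
    add_nonneg (norm_nonneg (g t)) (norm_nonneg (h t))
  have heg n := he n g hg fun t => le_add_of_nonneg_right (norm_nonneg _)
  have heh n := he n h hh fun t => le_add_of_nonneg_left (norm_nonneg _)
  refine MemHardy.of_tendsto (F := fun n => (e n * g) * (e n * h))
    (b := fun t => B * B * ‖(g * h) t‖)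
    (fun n => (heg n).1.mul_of_memLp_two (heh n).1 (heg n).2 (heh n).2)
    (hgh.norm.const_mul _) (fun n => ?_) ?_
  · filter_upwards [hbound n] with t ht
    have hB := mul_self_le_mul_self (norm_nonneg _) ht
    rw [mul_mul_mul_comm, Pi.mul_apply, norm_mul, Pi.mul_apply, norm_mul]
    gcongr
  · filter_upwards [hlim] with t ht
    simpa using (ht.mul_const (g t)).mul (ht.mul_const (h t))

theorem MemHardy.exists_factorization {g h : AddCircle T → ℂ} (hg : Integrable g μ)
    (hgh : MemHardy (g * h)) {δ : ℝ} (hδ : 0 < δ) :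
    ∃ E Q : AddCircle T → ℂ, MemHardy E ∧ MemHardy Q ∧ g * h =ᵐ[μ] E * Q ∧
      (∀ᵐ t ∂μ, ‖E t‖ = ‖g t‖ + δ) ∧ ∀ᵐ t ∂μ, ‖Q t‖ ≤ ‖h t‖ := by
  obtain ⟨E, hE, hE_inv, hE_norm⟩ := exists_outer (w := fun t => ‖g t‖ + δ)
    (hg.norm.add (integrable_const δ)) hδ fun t => le_add_of_nonneg_left (norm_nonneg (g t))
  have hpos (t : AddCircle T) : 0 < ‖g t‖ + δ := add_pos_of_nonneg_of_pos (norm_nonneg _) hδ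
  have hint : Integrable (E⁻¹ * (g * h)) μ := by
    refine hgh.1.bdd_mul (c := δ⁻¹) hE_inv.1.1 ?_
    filter_upwards [hE_norm] with t ht
    rw [Pi.inv_apply, norm_inv, ht]
    exact inv_anti₀ hδ (le_add_of_nonneg_left (norm_nonneg _))
  refine ⟨E, E⁻¹ * (g * h), hE, hE_inv.mul hgh hint, ?_, hE_norm, ?_⟩
  · filter_upwards [hE_norm] with t ht
    have hE0 : E t ≠ 0 := norm_ne_zero_iff.1 (ht ▸ (hpos t).ne')
    rw [Pi.mul_apply E, Pi.mul_apply E⁻¹, Pi.inv_apply, mul_inv_cancel_left₀ hE0]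
  · filter_upwards [hE_norm] with t ht
    rw [Pi.mul_apply, Pi.inv_apply, Pi.mul_apply, norm_mul, norm_inv, norm_mul, ht,
      inv_mul_le_iff₀ (hpos t)]
    gcongr
    exact le_add_of_nonneg_right hδ.le

end Circle

/-! ### Hardy spaces of function classes -/

namespace FunctionClass

/-- Order ideals of `L⁰` with a nonnegative monotone functional, containing `1` and hence the unit
ball of `L^∞`. No linear structure is involved, so quasi-normed spaces are covered. -/
structure IsSolid (X : FunctionClass) : Prop where
  one_mem : 1 ∈ X.carrier
  nrm_nonneg : ∀ f ∈ X.carrier, 0 ≤ X.nrm f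
  ideal : ∀ f ∈ X.carrier, ∀ g : LZero, (∀ᵐ t ∂torusMeasure, ‖g t‖ ≤ ‖f t‖) →
    g ∈ X.carrier ∧ X.nrm g ≤ X.nrm f

/-- Banach function spaces without completeness, definiteness of the norm and the semi-Fatou
property. -/
structure IsSolidSeminormed (X : FunctionClass) : Prop extends X.IsSolid where
  add_mem : ∀ f ∈ X.carrier, ∀ g ∈ X.carrier, f + g ∈ X.carrier
  smul_mem : ∀ (c : ℂ), ∀ f ∈ X.carrier, c • f ∈ X.carrier
  nrm_smul : ∀ (c : ℂ), ∀ f ∈ X.carrier, X.nrm (c • f) = ‖c‖ * X.nrm f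
  nrm_add_le : ∀ f ∈ X.carrier, ∀ g ∈ X.carrier, X.nrm (f + g) ≤ X.nrm f + X.nrm g

variable {X Y : FunctionClass}

theorem IsBanachFunctionSpace.isSolidSeminormed (hX : X.IsBanachFunctionSpace) :
    X.IsSolidSeminormed where
  one_mem := hX.linfty_subset 1 ((memLp_const (1 : ℂ)).ae_eq AEEqFun.coeFn_one.symm)
  nrm_nonneg := hX.nrm_nonneg
  ideal := hX.ideal
  add_mem := hX.add_mem
  smul_mem := hX.smul_mem
  nrm_smul := hX.nrm_smul
  nrm_add_le := hX.nrm_add_le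

theorem IsSolidSeminormed.mem_and_nrm_le_of_norm_le_add (hX : X.IsSolidSeminormed) {g G : LZero}
    (hg : g ∈ X.carrier) {δ : ℝ} (hδ : 0 ≤ δ) (hG : ∀ᵐ t ∂torusMeasure, ‖G t‖ ≤ ‖g t‖ + δ) :
    G ∈ X.carrier ∧ X.nrm G ≤ X.nrm g + δ * X.nrm 1 := by
  let a : LZero := AEEqFun.mk (fun t => ((‖g t‖ : ℝ) : ℂ))
    (Complex.continuous_ofReal.comp_aestronglyMeasurable g.aestronglyMeasurable.norm)
  have ha : ∀ᵐ t ∂torusMeasure, a t = ((‖g t‖ : ℝ) : ℂ) := AEEqFun.coeFn_mk _ _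
  obtain ⟨haX, ha_le⟩ := hX.ideal g hg a (by
    filter_upwards [ha] with t hat
    rw [hat, Complex.norm_real, norm_norm])
  have hδX := hX.smul_mem (δ : ℂ) 1 hX.one_mem
  obtain ⟨hGX, hG_le⟩ := hX.ideal _ (hX.add_mem a haX _ hδX) G (by
    filter_upwards [ha, hG, AEEqFun.coeFn_add a ((δ : ℂ) • (1 : LZero)),
      AEEqFun.coeFn_smul (δ : ℂ) (1 : LZero),
      AEEqFun.coeFn_one (α := Torus) (β := ℂ) (μ := torusMeasure)] with t hat hGt hadd hsmul hone
    rwa [hadd, Pi.add_apply, hsmul, Pi.smul_apply, hone, hat, Pi.one_apply, smul_eq_mul, mul_one,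
      ← Complex.ofReal_add, Complex.norm_real, Real.norm_of_nonneg (by positivity)])
  refine ⟨hGX, hG_le.trans ((hX.nrm_add_le a haX _ hδX).trans ?_)⟩
  rw [hX.nrm_smul _ _ hX.one_mem, Complex.norm_real, Real.norm_of_nonneg hδ]
  gcongr

theorem prod_nrm_le (hX : ∀ g ∈ X.carrier, 0 ≤ X.nrm g) (hY : ∀ h ∈ Y.carrier, 0 ≤ Y.nrm h)
    {g h : LZero} (hg : g ∈ X.carrier) (hh : h ∈ Y.carrier) :
    (X.prod Y).nrm (g * h) ≤ X.nrm g * Y.nrm h := by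
  refine csInf_le ⟨0, ?_⟩ ⟨g, hg, h, hh, rfl, rfl⟩
  rintro _ ⟨a, ha, b, hb, -, rfl⟩
  exact mul_nonneg (hX a ha) (hY b hb)

theorem le_prod_nrm {f : LZero} (hf : f ∈ (X.prod Y).carrier) {r : ℝ}
    (h : ∀ a ∈ X.carrier, ∀ b ∈ Y.carrier, f = a * b → r ≤ X.nrm a * Y.nrm b) :
    r ≤ (X.prod Y).nrm f := by
  obtain ⟨a₀, ha₀, b₀, hb₀, hf₀⟩ := hf
  refine le_csInf ⟨_, a₀, ha₀, b₀, hb₀, hf₀, rfl⟩ ?_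
  rintro _ ⟨a, ha, b, hb, hab, rfl⟩
  exact h a ha b hb hab

theorem SubsetLOne.left (hXY : (X.prod Y).SubsetLOne) (hY : 1 ∈ Y.carrier) : X.SubsetLOne :=
  fun g hg => hXY g ⟨g, hg, 1, hY, (mul_one g).symm⟩

theorem SubsetLOne.hardy_prod_hardy_subset (hXY : (X.prod Y).SubsetLOne) :
    (X.hardy.prod Y.hardy).carrier ⊆ (X.prod Y).hardy.carrier := by
  rintro _ ⟨g, hg, h, hh, rfl⟩
  have hgh : g * h ∈ (X.prod Y).carrier := ⟨g, hg.1, h, hh.1, rfl⟩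
  have hcoe := AEEqFun.coeFn_mul g h
  exact ⟨hgh, (MemHardy.mul hg.2 hh.2 ((hXY _ hgh).congr hcoe)).congr hcoe.symm⟩

theorem exists_hardy_factorization (hX : X.IsSolidSeminormed) (hY : Y.IsSolid)
    {g h : LZero} (hg : g ∈ X.carrier) (hg1 : Integrable g torusMeasure) (hh : h ∈ Y.carrier)
    (hgh : MemHardy (g * h : LZero)) {δ : ℝ} (hδ : 0 < δ) :
    ∃ G ∈ X.hardy.carrier, ∃ H ∈ Y.hardy.carrier, g * h = G * H ∧
      X.nrm G ≤ X.nrm g + δ * X.nrm 1 ∧ Y.nrm H ≤ Y.nrm h := by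
  have hcoe := AEEqFun.coeFn_mul g h
  obtain ⟨E, Q, hE, hQ, hEQ, hE_norm, hQ_norm⟩ :=
    MemHardy.exists_factorization hg1 (hgh.congr hcoe) hδ
  let G : LZero := AEEqFun.mk E hE.1.1
  let H : LZero := AEEqFun.mk Q hQ.1.1
  have hG : G =ᵐ[torusMeasure] E := AEEqFun.coeFn_mk _ _
  have hH : H =ᵐ[torusMeasure] Q := AEEqFun.coeFn_mk _ _
  obtain ⟨hGX, hG_le⟩ := hX.mem_and_nrm_le_of_norm_le_add (G := G) hg hδ.le (by
    filter_upwards [hG, hE_norm] with t hGt hEt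
    rw [hGt, hEt])
  obtain ⟨hHY, hH_le⟩ := hY.ideal h hh H (by
    filter_upwards [hH, hQ_norm] with t hHt hQt
    rwa [hHt])
  refine ⟨G, ⟨hGX, hE.congr hG.symm⟩, H, ⟨hHY, hQ.congr hH.symm⟩, AEEqFun.ext ?_, hG_le, hH_le⟩
  exact hcoe.trans (hEQ.trans ((hG.mul hH).symm.trans (AEEqFun.coeFn_mul G H).symm))

theorem hardy_prod_hardy_nrm_mul_le (hX : X.IsSolidSeminormed) (hY : Y.IsSolid)
    {g h : LZero} (hg : g ∈ X.carrier) (hg1 : Integrable g torusMeasure) (hh : h ∈ Y.carrier)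
    (hgh : MemHardy (g * h : LZero)) :
    (X.hardy.prod Y.hardy).nrm (g * h) ≤ X.nrm g * Y.nrm h := by
  have hbound : ∀ δ > 0, (X.hardy.prod Y.hardy).nrm (g * h) ≤
      (X.nrm g + δ * X.nrm 1) * Y.nrm h := fun δ hδ => by
    obtain ⟨G, hG, H, hH, hGH, hG_le, hH_le⟩ := exists_hardy_factorization hX hY hg hg1 hh hgh hδ
    have hH0 := hY.nrm_nonneg H hH.1
    calc (X.hardy.prod Y.hardy).nrm (g * h) ≤ X.nrm G * Y.nrm H :=
          hGH ▸ prod_nrm_le (X := X.hardy) (Y := Y.hardy) (fun a ha => hX.nrm_nonneg a ha.1)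
            (fun b hb => hY.nrm_nonneg b hb.1) hG hH
      _ ≤ (X.nrm g + δ * X.nrm 1) * Y.nrm h :=
          mul_le_mul hG_le hH_le hH0 ((hX.nrm_nonneg G hG.1).trans hG_le)
  have hcont : Continuous fun δ : ℝ => (X.nrm g + δ * X.nrm 1) * Y.nrm h := by fun_prop
  have hlim := (hcont.tendsto 0).mono_left (nhdsWithin_le_nhds (s := Set.Ioi 0))
  rw [zero_mul, add_zero] at hlim
  exact ge_of_tendsto hlim (eventually_mem_nhdsWithin.mono hbound)

end FunctionClass

theorem theorem5p1_general {X Y : FunctionClass} (hX : X.IsSolidSeminormed) (hY : Y.IsSolid)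
    (hXY : (X.prod Y).SubsetLOne) :
    (X.hardy.prod Y.hardy).IsometricallyEqual (X.prod Y).hardy := by
  have hX1 : X.SubsetLOne := hXY.left hY.one_mem
  have hsub := hXY.hardy_prod_hardy_subset
  refine ⟨Set.Subset.antisymm hsub ?_, fun f hf => le_antisymm ?_ ?_⟩
  · rintro _ ⟨⟨g, hg, h, hh, rfl⟩, hgh⟩
    obtain ⟨G, hG, H, hH, hGH, -⟩ :=
      FunctionClass.exists_hardy_factorization hX hY hg (hX1 g hg) hh hgh one_pos
    exact ⟨G, hG, H, hH, hGH⟩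
  · refine FunctionClass.le_prod_nrm (hsub hf).1 ?_
    rintro g hg h hh rfl
    exact FunctionClass.hardy_prod_hardy_nrm_mul_le hX hY hg (hX1 g hg) hh (hsub hf).2
  · refine FunctionClass.le_prod_nrm hf ?_
    rintro g hg h hh rfl
    exact FunctionClass.prod_nrm_le hX.nrm_nonneg hY.nrm_nonneg hg.1 hh.1

theorem theorem5p1 (X Y : FunctionClass)
    (hX : X.IsBanachFunctionSpace) (hXri : X.IsRearrangementInvariant)
    (hY : Y.IsBanachFunctionSpace) (hYri : Y.IsRearrangementInvariant)
    (hXY : (X.prod Y).SubsetLOne) :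
    (X.hardy.prod Y.hardy).IsometricallyEqual (X.prod Y).hardy :=
  theorem5p1_general hX.isSolidSeminormed hY.isSolidSeminormed.toIsSolid hXY
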